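/- CircularNim $CN(n,k)$ is played on $n$ stacks of tokens arranged in a circle, labelled $0,\dots,n-1$ modulo $n$; a move consists of choosing $k$ consecutive stacks and removing at least one token in total from them (any number from each). The last player to move wins. Let $\mathcal P_{n,k}\subseteq\mathbb N^n$ (where $0\in\mathbb N$) be the set of P-positions, i.e. the positions from which the player about to move loses under optimal play. For $p=(p_0,\dots,p_7)\in\mathbb N^8$ put $a=\min(p_0,p_2,p_4,p_6)$ and $b=\min(p_1,p_3,p_5,p_7)$, let $x_i=p_i-a$ for even $i$ and $x_i=p_i-b$ for odd $i$, and let $\bar p=(x_1,x_2,x_4,x_5+x_6,x_7)$. Theorem. (1) A position $p$ of $CN(8,3)$ is a P-position if and only if its stacks can be relabelled, by a rotation or reflection of the circle, so that $a\le b$, $p_0=a$ (i.e. $x_0=0$), $x_3=0$ (so minima of the two squares occur at distance three), and $\bar p\in\mathcal P_{5,2}$. (2) The criterion does not depend on the choice of labelling: for every $p\in\mathbb N^8$ with $p_0=a$ and $x_3=0$, we have $p\in\mathcal P_{8,3}$ if and only if $\bar p\in\mathcal P_{5,2}$. -/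

import Mathlib

/-- A move of the game SetNim with collection of move sets `𝒜`, on stacks indexed by `V`:
choose `A ∈ 𝒜`, and take at least one token in total from the stacks in `A`
(any number of tokens from each of them), leaving all other stacks alone. -/
def SetNim.Move {V : Type*} (𝒜 : Set (Finset V)) (p q : V → ℕ) : Prop :=
  ∃ A ∈ 𝒜, (∀ i ∈ A, q i ≤ p i) ∧ (∃ i ∈ A, q i < p i) ∧ ∀ i, i ∉ A → q i = p i

theorem SetNim.Move.sum_lt {V : Type*} [Fintype V] {𝒜 : Set (Finset V)} {p q : V → ℕ}
    (h : SetNim.Move 𝒜 p q) : ∑ i, q i < ∑ i, p i := by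
  obtain ⟨A, -, hle, ⟨i, hi, hlt⟩, heq⟩ := h
  refine Finset.sum_lt_sum (fun j _ => ?_) ⟨i, Finset.mem_univ i, hlt⟩
  by_cases hj : j ∈ A
  · exact hle j hj
  · exact (heq j hj).le

/-- `p` is a P-position of SetNim under normal play (the player who cannot move loses):
no option of `p` is a P-position. -/
def SetNim.IsPPosition {V : Type*} [Fintype V] (𝒜 : Set (Finset V)) (p : V → ℕ) : Prop :=
  ∀ q : V → ℕ, SetNim.Move 𝒜 p q → ¬ SetNim.IsPPosition 𝒜 q
termination_by ∑ i, p i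
decreasing_by
  rename_i h
  exact h.sum_lt

/-- The move sets of CircularNim CN(n,k): the sets `{i, i+1, …, i+k-1}` of `k` consecutive
stacks on a circle of `n` stacks (addition in `Fin n` is modulo `n`). -/
def CircularNim.moveSets (n k : ℕ) [NeZero n] : Set (Finset (Fin n)) :=
  {A | ∃ i : Fin n, A = (Finset.range k).image (fun j : ℕ => i + Fin.ofNat n j)}

/-- The set of P-positions of CN(n,k). -/
def CircularNim.PPositions (n k : ℕ) [NeZero n] : Set (Fin n → ℕ) :=
  {p | SetNim.IsPPosition (CircularNim.moveSets n k) p}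

/-- `q` is obtained from `p` by rotating and possibly reflecting the circle of `n` stacks. -/
def CircularNim.IsRelabeling {n : ℕ} [NeZero n] (p q : Fin n → ℕ) : Prop :=
  ∃ c : Fin n, (∀ i, q i = p (c + i)) ∨ (∀ i, q i = p (c - i))

/-- The minimum `a` of the square `(p₀, p₂, p₄, p₆)`. -/
def CN83.a (p : Fin 8 → ℕ) : ℕ := min (min (p 0) (p 2)) (min (p 4) (p 6))

/-- The minimum `b` of the square `(p₁, p₃, p₅, p₇)`. -/
def CN83.b (p : Fin 8 → ℕ) : ℕ := min (min (p 1) (p 3)) (min (p 5) (p 7))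

/-- The excess `xᵢ` of a stack over the minimum of its square
(the subtraction is never truncated). -/
def CN83.x (p : Fin 8 → ℕ) (i : Fin 8) : ℕ :=
  p i - (if i.val % 2 = 0 then CN83.a p else CN83.b p)

/-- The reduced 5-tuple `(x₁, x₂, x₄, x₅ + x₆, x₇)`. -/
def CN83.reduced (p : Fin 8 → ℕ) : Fin 5 → ℕ :=
  ![CN83.x p 1, CN83.x p 2, CN83.x p 4, CN83.x p 5 + CN83.x p 6, CN83.x p 7]

open SetNim

/-! ### P-positions as kernels -/

namespace SetNim

/-! Both games are solved by exhibiting a kernel: a set with no move inside it that can be entered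
from every position outside it. For CN(5,2) the kernel consists of the balanced circles; for
CN(8,3), of the positions that become normal after a rotation.

The link is geometric. If stacks 0 and 3 have excess zero, deleting them and merging 5 with 6 leaves
the circle 1, 2, 4, 5+6, 7, and each pair of neighbours there lies in a window of three stacks of
the octagon. So every move of CN(5,2) lifts (`reaches_of_minima`). If no minima at distance three
are at hand, they can be taken adjacent, and explicit moves create suitable ones
(`reaches_of_adjacent_minima`).

The converse does not come from lifting, since a move may lower or relocate the minima.
`IsNormal.rotate` says that normality is the same for every pair of minima at distance three. A
window cannot contain both minima of the new pair, so one old minimum survives, and up to reflection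
it is stack 3. Few new pairs then remain, each settled by linear arithmetic
(`IsNormal.not_isNormal_rotate`). Reflection exchanges the two squares, which gives a ≤ b. -/

/-- A set of positions without internal moves that can be entered by a move from every other
position is the set of P-positions. -/
theorem isPPosition_iff_of_kernel {V : Type*} [Fintype V] {𝒜 : Set (Finset V)}
    {S : (V → ℕ) → Prop} (stable : ∀ p q, S p → Move 𝒜 p q → ¬ S q)
    (absorbing : ∀ p, ¬ S p → ∃ q, Move 𝒜 p q ∧ S q) (p : V → ℕ) :
    IsPPosition 𝒜 p ↔ S p := by
  induction hn : ∑ i, p i using Nat.strong_induction_on generalizing p with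
  | _ n ih =>
    subst hn
    rw [IsPPosition]
    constructor
    · intro h
      by_contra hS
      obtain ⟨q, hm, hq⟩ := absorbing p hS
      exact h q hm ((ih _ hm.sum_lt q rfl).2 hq)
    · intro h q hm hq
      exact stable p q h hm ((ih _ hm.sum_lt q rfl).1 hq)

end SetNim

/-! ### Moves as fixing the complement of a window -/

namespace CircularNim

theorem move_iff {n k : ℕ} [NeZero n] {p q : Fin n → ℕ} :
    Move (moveSets n k) p q ↔ p ≠ q ∧ (∀ j, q j ≤ p j) ∧
      ∃ i : Fin n, ∀ j, (∀ l < k, j ≠ i + Fin.ofNat n l) → q j = p j := by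
  constructor
  · rintro ⟨A, ⟨i, rfl⟩, hle, ⟨j, -, hj⟩, heq⟩
    refine ⟨fun h => hj.ne (congrFun h j).symm, fun j => ?_, i, fun j h => heq j ?_⟩
    · by_cases h : j ∈ (Finset.range k).image (fun j : ℕ => i + Fin.ofNat n j)
      · exact hle j h
      · exact (heq j h).le
    · simp only [Finset.mem_image, Finset.mem_range, not_exists, not_and]
      exact fun l hl e => h l hl e.symm
  · rintro ⟨hne, hle, i, heq⟩
    refine ⟨_, ⟨i, rfl⟩, fun j _ => hle j, ?_, fun j hj => heq j fun l hl e => hj ?_⟩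
    · obtain ⟨j, hj⟩ := Function.ne_iff.1 hne
      refine ⟨j, ?_, lt_of_le_of_ne (hle j) hj.symm⟩
      by_contra h
      refine hj (heq j fun l hl e => h ?_).symm
      exact Finset.mem_image.2 ⟨l, Finset.mem_range.2 hl, e.symm⟩
    · exact Finset.mem_image.2 ⟨l, Finset.mem_range.2 hl, e.symm⟩

theorem move_five_two_iff {p q : Fin 5 → ℕ} :
    Move (moveSets 5 2) p q ↔ p ≠ q ∧ (∀ j, q j ≤ p j) ∧
      ∃ i : Fin 5, q (i + 2) = p (i + 2) ∧ q (i + 3) = p (i + 3) ∧ q (i + 4) = p (i + 4) := by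
  rw [move_iff]
  refine and_congr_right fun _ => and_congr_right fun _ => exists_congr fun i => ?_
  have key : ∀ i j : Fin 5, (∀ l < 2, j ≠ i + Fin.ofNat 5 l) ↔
      j = i + 2 ∨ j = i + 3 ∨ j = i + 4 := by decide
  simp only [key, or_imp, forall_and, forall_eq]

theorem move_eight_three_iff {p q : Fin 8 → ℕ} :
    Move (moveSets 8 3) p q ↔ p ≠ q ∧ (∀ j, q j ≤ p j) ∧
      ∃ i : Fin 8, q (i + 3) = p (i + 3) ∧ q (i + 4) = p (i + 4) ∧ q (i + 5) = p (i + 5) ∧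
        q (i + 6) = p (i + 6) ∧ q (i + 7) = p (i + 7) := by
  rw [move_iff]
  refine and_congr_right fun _ => and_congr_right fun _ => exists_congr fun i => ?_
  have key : ∀ i j : Fin 8, (∀ l < 3, j ≠ i + Fin.ofNat 8 l) ↔
      j = i + 3 ∨ j = i + 4 ∨ j = i + 5 ∨ j = i + 6 ∨ j = i + 7 := by decide
  simp only [key, or_imp, forall_and, forall_eq]

end CircularNim

/-! ### The P-positions of CN(5,2) -/

namespace CN52

/-- `m` is a largest entry of the circle `(m, u, v, w, u')`, its neighbours `u` and `u'` agree,
and `m + u = v + w`. -/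
def Balanced (m u v w u' : ℕ) : Prop := u = u' ∧ m + u = v + w ∧ v ≤ m ∧ w ≤ m

/-- Some rotation of the circle is balanced. These are the P-positions of CN(5,2). -/
def IsBalanced (a b c d e : ℕ) : Prop :=
  Balanced a b c d e ∨ Balanced b c d e a ∨ Balanced c d e a b ∨ Balanced d e a b c ∨
    Balanced e a b c d

variable {a b c d e : ℕ}

theorem IsBalanced.rotate (h : IsBalanced a b c d e) : IsBalanced b c d e a := by
  unfold IsBalanced at *; tauto

theorem Balanced.reverse (h : Balanced a b c d e) : Balanced a e d c b := by
  unfold Balanced at *; omega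

theorem IsBalanced.reverse (h : IsBalanced a b c d e) : IsBalanced e d c b a := by
  rcases h with h | h | h | h | h
  · exact .inr (.inr (.inr (.inr h.reverse)))
  · exact .inr (.inr (.inr (.inl h.reverse)))
  · exact .inr (.inr (.inl h.reverse))
  · exact .inr (.inl h.reverse)
  · exact .inl h.reverse

theorem IsBalanced.eq_of_le {a' b' : ℕ} (h : IsBalanced a b c d e) (h' : IsBalanced a' b' c d e)
    (ha : a' ≤ a) (hb : b' ≤ b) : a' = a ∧ b' = b := by
  rcases h with h | h | h | h | h <;> rcases h' with h' | h' | h' | h' | h' <;>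
    simp only [Balanced] at h h' <;> omega

/-- With two non-adjacent zeros balance is additive, so it survives a different merging of stacks.
-/
theorem isBalanced_zero_zero_iff : IsBalanced a b 0 d 0 ↔ d = a + b := by
  unfold IsBalanced Balanced; omega

/-- A balanced circle lies below the given one and differs from it in at most two adjacent
entries. -/
def Reaches (a b c d e : ℕ) : Prop :=
  ∃ a' b' c' d' e', IsBalanced a' b' c' d' e' ∧ a' ≤ a ∧ b' ≤ b ∧ c' ≤ c ∧ d' ≤ d ∧ e' ≤ e ∧
    ((c' = c ∧ d' = d ∧ e' = e) ∨ (d' = d ∧ e' = e ∧ a' = a) ∨ (e' = e ∧ a' = a ∧ b' = b) ∨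
      (a' = a ∧ b' = b ∧ c' = c) ∨ (b' = b ∧ c' = c ∧ d' = d))

theorem Reaches.rotate (h : Reaches a b c d e) : Reaches b c d e a := by
  obtain ⟨a', b', c', d', e', h, h1, h2, h3, h4, h5, h6⟩ := h
  exact ⟨b', c', d', e', a', h.rotate, h2, h3, h4, h5, h1, by tauto⟩

theorem Reaches.reverse (h : Reaches a b c d e) : Reaches e d c b a := by
  obtain ⟨a', b', c', d', e', h, h1, h2, h3, h4, h5, h6⟩ := h
  exact ⟨e', d', c', b', a', h.reverse, h5, h4, h3, h2, h1, by tauto⟩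

theorem Balanced.isBalanced (h : Balanced a b c d e) : IsBalanced a b c d e := Or.inl h

/-- The cases decide which entry of the target is its largest one `m`; the lowered entries are then
solved for from `u = u'` and `m + u = v + w`. -/
theorem reaches_of_max_of_le (_hb : b ≤ a) (hc : c ≤ a) (hd : d ≤ a) (_he : e ≤ a) (hbe : b ≤ e) :
    Reaches a b c d e := by
  by_cases h1 : a + b ≤ c + d
  · exact ⟨a, b, c, a + b - c, b, Balanced.isBalanced (by unfold Balanced; omega), by omega⟩
  by_cases h2 : b ≤ c ∧ b ≤ d
  · exact ⟨c + d - b, b, c, d, b, Balanced.isBalanced (by unfold Balanced; omega), by omega⟩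
  by_cases h3 : c ≤ d
  · by_cases h4 : b ≤ d
    · exact ⟨d + c - b, b, c, d, c,
        (Balanced.isBalanced (by unfold Balanced; omega : Balanced d c (d + c - b) b c)).rotate.rotate,
        by omega⟩
    · exact ⟨c, b, c, d, b + c - d,
        (Balanced.isBalanced
          (by unfold Balanced; omega : Balanced b c d (b + c - d) c)).rotate.rotate.rotate.rotate,
        by omega⟩
  by_cases h4 : e ≤ c
  · exact ⟨c + d - e, d, c, d, e,
      (Balanced.isBalanced
        (by unfold Balanced; omega : Balanced c d e (c + d - e) d)).rotate.rotate.rotate, by omega⟩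
  by_cases h5 : b + c ≤ d + e
  · exact ⟨d, b, c, d, b + c - d,
      (Balanced.isBalanced (by unfold Balanced; omega : Balanced (b + c - d) d b c d)).rotate,
      by omega⟩
  · exact ⟨d, e + d - c, c, d, e,
      (Balanced.isBalanced (by unfold Balanced; omega : Balanced e d (e + d - c) c d)).rotate,
      by omega⟩

theorem reaches_of_max (hb : b ≤ a) (hc : c ≤ a) (hd : d ≤ a) (he : e ≤ a) :
    Reaches a b c d e := by
  rcases le_total b e with h | h
  · exact reaches_of_max_of_le hb hc hd he h
  · exact (reaches_of_max_of_le he hd hc hb h).reverse.rotate.rotate.rotate.rotate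

theorem reaches (a b c d e : ℕ) : Reaches a b c d e := by
  have : (b ≤ a ∧ c ≤ a ∧ d ≤ a ∧ e ≤ a) ∨ (c ≤ b ∧ d ≤ b ∧ e ≤ b ∧ a ≤ b) ∨
      (d ≤ c ∧ e ≤ c ∧ a ≤ c ∧ b ≤ c) ∨ (e ≤ d ∧ a ≤ d ∧ b ≤ d ∧ c ≤ d) ∨
      (a ≤ e ∧ b ≤ e ∧ c ≤ e ∧ d ≤ e) := by omega
  rcases this with ⟨h1, h2, h3, h4⟩ | ⟨h1, h2, h3, h4⟩ | ⟨h1, h2, h3, h4⟩ | ⟨h1, h2, h3, h4⟩ |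
    ⟨h1, h2, h3, h4⟩
  · exact reaches_of_max h1 h2 h3 h4
  · exact (reaches_of_max h1 h2 h3 h4).rotate.rotate.rotate.rotate
  · exact (reaches_of_max h1 h2 h3 h4).rotate.rotate.rotate
  · exact (reaches_of_max h1 h2 h3 h4).rotate.rotate
  · exact (reaches_of_max h1 h2 h3 h4).rotate

theorem mem_pPositions_iff (r : Fin 5 → ℕ) :
    r ∈ CircularNim.PPositions 5 2 ↔ IsBalanced (r 0) (r 1) (r 2) (r 3) (r 4) := by
  refine SetNim.isPPosition_iff_of_kernel
    (S := fun r : Fin 5 → ℕ => IsBalanced (r 0) (r 1) (r 2) (r 3) (r 4)) ?_ ?_ r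
  · intro p q hp hm hq
    obtain ⟨hne, hle, i, h2, h3, h4⟩ := CircularNim.move_five_two_iff.1 hm
    have key : ∀ i : Fin 5, IsBalanced (p i) (p (i + 1)) (p (i + 2)) (p (i + 3)) (p (i + 4)) ∧
        IsBalanced (q i) (q (i + 1)) (q (i + 2)) (q (i + 3)) (q (i + 4)) := by
      rw [Fin.forall_fin_succ, Fin.forall_fin_succ, Fin.forall_fin_succ, Fin.forall_fin_succ,
        Fin.forall_fin_one]
      exact ⟨⟨hp, hq⟩, ⟨hp.rotate, hq.rotate⟩, ⟨hp.rotate.rotate, hq.rotate.rotate⟩,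
        ⟨hp.rotate.rotate.rotate, hq.rotate.rotate.rotate⟩,
        ⟨hp.rotate.rotate.rotate.rotate, hq.rotate.rotate.rotate.rotate⟩⟩
    obtain ⟨hp', hq'⟩ := key i
    rw [h2, h3, h4] at hq'
    obtain ⟨h0, h1⟩ := hp'.eq_of_le hq' (hle _) (hle _)
    refine hne (funext fun j => ?_)
    have cover : ∀ i j : Fin 5, j = i ∨ j = i + 1 ∨ j = i + 2 ∨ j = i + 3 ∨ j = i + 4 := by decide
    rcases cover i j with rfl | rfl | rfl | rfl | rfl
    exacts [h0.symm, h1.symm, h2.symm, h3.symm, h4.symm]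
  · intro p hp
    obtain ⟨a, b, c, d, e, h, ha, hb, hc, hd, he, hm⟩ := reaches (p 0) (p 1) (p 2) (p 3) (p 4)
    refine ⟨![a, b, c, d, e], CircularNim.move_five_two_iff.2 ⟨?_, ?_, ?_⟩, h⟩
    · rintro hpq
      rw [hpq] at hp
      exact hp h
    · simp only [Fin.forall_fin_succ, Fin.forall_fin_zero]
      exact ⟨ha, hb, hc, hd, he, trivial⟩
    · rcases hm with hm | hm | hm | hm | hm
      exacts [⟨0, hm⟩, ⟨1, hm⟩, ⟨2, hm⟩, ⟨3, hm⟩, ⟨4, hm⟩]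

end CN52

open CN52 CircularNim

/-! ### Normal positions and their symmetries -/

namespace CN83

/-- The minima of the two squares are attained at `0` and `3`, and the reduced circle is
balanced. -/
def IsNormal (p : Fin 8 → ℕ) : Prop :=
  (p 0 ≤ p 2 ∧ p 0 ≤ p 4 ∧ p 0 ≤ p 6) ∧ (p 3 ≤ p 1 ∧ p 3 ≤ p 5 ∧ p 3 ≤ p 7) ∧
    IsBalanced (p 1 - p 3) (p 2 - p 0) (p 4 - p 0) ((p 5 - p 3) + (p 6 - p 0)) (p 7 - p 3)

theorem IsNormal.exists_excess {p : Fin 8 → ℕ} (h : IsNormal p) :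
    ∃ a b x₁ x₂ x₄ x₅ x₆ x₇ : ℕ, (p 0 = a ∧ p 1 = b + x₁ ∧ p 2 = a + x₂ ∧ p 3 = b ∧
      p 4 = a + x₄ ∧ p 5 = b + x₅ ∧ p 6 = a + x₆ ∧ p 7 = b + x₇) ∧
      IsBalanced x₁ x₂ x₄ (x₅ + x₆) x₇ := by
  obtain ⟨h0, h3, h⟩ := h
  exact ⟨p 0, p 3, _, _, _, _, _, _, by omega, h⟩

theorem isNormal_of_excess {p : Fin 8 → ℕ} {a b x₁ x₂ x₄ x₅ x₆ x₇ : ℕ}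
    (hp : p 0 = a ∧ p 1 = b + x₁ ∧ p 2 = a + x₂ ∧ p 3 = b ∧
      p 4 = a + x₄ ∧ p 5 = b + x₅ ∧ p 6 = a + x₆ ∧ p 7 = b + x₇)
    (h : IsBalanced x₁ x₂ x₄ (x₅ + x₆) x₇) : IsNormal p := by
  obtain ⟨h0, h1, h2, h3, h4, h5, h6, h7⟩ := hp
  refine ⟨by omega, by omega, ?_⟩
  simpa [h0, h1, h2, h3, h4, h5, h6, h7] using h

theorem fin_eight_cases (c : Fin 8) :
    c = 0 ∨ c = 1 ∨ c = 2 ∨ c = 3 ∨ c = 4 ∨ c = 5 ∨ c = 6 ∨ c = 7 := by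
  revert c; decide

/-- The reflection swaps the minima 0 and 3, keeps the merged pair 5, 6, and reverses the reduced
circle. -/
theorem IsNormal.reflect {p : Fin 8 → ℕ} (h : IsNormal p) : IsNormal fun i => p (3 - i) := by
  obtain ⟨h0, h3, h⟩ := h
  refine ⟨⟨h3.1, h3.2.2, h3.2.1⟩, ⟨h0.1, h0.2.2, h0.2.1⟩, ?_⟩
  have := h.reverse.rotate.rotate.rotate
  rw [add_comm] at this
  exact this

/-- Normality does not depend on the choice of the pair of minima at distance three. -/
theorem IsNormal.rotate {p : Fin 8 → ℕ} (h : IsNormal p) {c : Fin 8}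
    (hc : p c ≤ p (c + 2) ∧ p c ≤ p (c + 4) ∧ p c ≤ p (c + 6))
    (hc' : p (c + 3) ≤ p (c + 1) ∧ p (c + 3) ≤ p (c + 5) ∧ p (c + 3) ≤ p (c + 7)) :
    IsNormal fun i => p (c + i) := by
  obtain ⟨a, b, x₁, x₂, x₄, x₅, x₆, x₇, ⟨h0, h1, h2, h3, h4, h5, h6, h7⟩, h⟩ := h.exists_excess
  -- For `c` = 2, 3, 5, 6 the new minima make the reduced circle a mere rotation of the old one. For
  -- `c` = 1, 4, 7 the merging changes, but two non-adjacent zeros make balance additive.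
  rcases fin_eight_cases c with rfl | rfl | rfl | rfl | rfl | rfl | rfl | rfl <;>
    simp only [Fin.reduceAdd, Fin.isValue] at hc hc'
  · simpa using ‹IsNormal p›
  · obtain rfl : x₁ = 0 := by omega
    obtain rfl : x₄ = 0 := by omega
    refine isNormal_of_excess (a := b) (b := a) (x₁ := x₂) (x₂ := 0) (x₄ := x₅) (x₅ := x₆)
      (x₆ := x₇) (x₇ := 0) (by simp [*]) ?_
    have := isBalanced_zero_zero_iff.1 h.rotate.rotate.rotate
    exact (isBalanced_zero_zero_iff.2 (by omega)).rotate.rotate.rotate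
  · obtain rfl : x₂ = 0 := by omega
    obtain rfl : x₅ = 0 := by omega
    refine isNormal_of_excess (a := a) (b := b) (x₁ := 0) (x₂ := x₄) (x₄ := x₆) (x₅ := x₇)
      (x₆ := 0) (x₇ := x₁) (by simp [*]) ?_
    simpa using h.rotate
  · obtain rfl : x₆ = 0 := by omega
    refine isNormal_of_excess (a := b) (b := a) (x₁ := x₄) (x₂ := x₅) (x₄ := x₇) (x₅ := 0)
      (x₆ := x₁) (x₇ := x₂) (by simp [*]) ?_
    simpa using h.rotate.rotate
  · obtain rfl : x₄ = 0 := by omega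
    obtain rfl : x₇ = 0 := by omega
    refine isNormal_of_excess (a := a) (b := b) (x₁ := x₅) (x₂ := x₆) (x₄ := 0) (x₅ := x₁)
      (x₆ := x₂) (x₇ := 0) (by simp [*]) ?_
    have := isBalanced_zero_zero_iff.1 h
    exact isBalanced_zero_zero_iff.2 (by omega)
  · obtain rfl : x₅ = 0 := by omega
    refine isNormal_of_excess (a := b) (b := a) (x₁ := x₆) (x₂ := x₇) (x₄ := x₁) (x₅ := x₂)
      (x₆ := 0) (x₇ := x₄) (by simp [*]) ?_
    simpa using h.rotate.rotate.rotate
  · obtain rfl : x₁ = 0 := by omega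
    obtain rfl : x₆ = 0 := by omega
    refine isNormal_of_excess (a := a) (b := b) (x₁ := x₇) (x₂ := 0) (x₄ := x₂) (x₅ := 0)
      (x₆ := x₄) (x₇ := x₅) (by simp [*]) ?_
    simpa using h.rotate.rotate.rotate.rotate
  · obtain rfl : x₂ = 0 := by omega
    obtain rfl : x₇ = 0 := by omega
    refine isNormal_of_excess (a := b) (b := a) (x₁ := 0) (x₂ := x₁) (x₄ := 0) (x₅ := x₄)
      (x₆ := x₅) (x₇ := x₆) (by simp [*]) ?_
    have := isBalanced_zero_zero_iff.1 h.rotate.rotate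
    exact (isBalanced_zero_zero_iff.2 (by omega)).rotate.rotate

/-- A normal position after a relabelling of the circle. -/
def IsNormalizable (p : Fin 8 → ℕ) : Prop := ∃ c : Fin 8, IsNormal fun i => p (c + i)

theorem IsNormalizable.of_rotate {p : Fin 8 → ℕ} {c : Fin 8}
    (h : IsNormalizable fun i => p (c + i)) : IsNormalizable p := by
  obtain ⟨d, h⟩ := h
  exact ⟨c + d, by simpa only [add_assoc] using h⟩

/-! ### Every position reaches a normalizable one -/

/-- A normalizable position lies below the given one and differs from it on at most three
consecutive stacks. -/
def Reaches (p : Fin 8 → ℕ) : Prop :=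
  ∃ q, IsNormalizable q ∧ (∀ j, q j ≤ p j) ∧
      ∃ i : Fin 8, q (i + 3) = p (i + 3) ∧ q (i + 4) = p (i + 4) ∧ q (i + 5) = p (i + 5) ∧
        q (i + 6) = p (i + 6) ∧ q (i + 7) = p (i + 7)

theorem Reaches.of_rotate {p : Fin 8 → ℕ} {c : Fin 8} (h : Reaches fun i => p (c + i)) :
    Reaches p := by
  obtain ⟨q, hq, hle, i, hi⟩ := h
  refine ⟨fun i => q (-c + i), ?_, fun j => ?_, c + i, ?_⟩
  · obtain ⟨d, hd⟩ := hq
    exact ⟨c + d, by simpa only [add_assoc, neg_add_cancel_left] using hd⟩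
  · simpa only [add_neg_cancel_left] using hle (-c + j)
  · simpa only [add_assoc, neg_add_cancel_left] using hi

theorem reaches_of_minima {p : Fin 8 → ℕ} (h0 : p 0 ≤ p 2 ∧ p 0 ≤ p 4 ∧ p 0 ≤ p 6)
    (h3 : p 3 ≤ p 1 ∧ p 3 ≤ p 5 ∧ p 3 ≤ p 7) : Reaches p := by
  obtain ⟨x₁, h1⟩ := Nat.exists_eq_add_of_le h3.1
  obtain ⟨x₂, h2⟩ := Nat.exists_eq_add_of_le h0.1
  obtain ⟨x₄, h4⟩ := Nat.exists_eq_add_of_le h0.2.1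
  obtain ⟨x₅, h5⟩ := Nat.exists_eq_add_of_le h3.2.1
  obtain ⟨x₆, h6⟩ := Nat.exists_eq_add_of_le h0.2.2
  obtain ⟨x₇, h7⟩ := Nat.exists_eq_add_of_le h3.2.2
  obtain ⟨y₁, y₂, y₄, y, y₇, h, l1, l2, l4, l, l7, hm⟩ := CN52.reaches x₁ x₂ x₄ (x₅ + x₆) x₇
  -- An unchanged merged entry must leave both of its stacks unchanged; the bounds force this.
  obtain ⟨y₅, y₆, rfl, l5, l6⟩ : ∃ y₅ y₆, y = y₅ + y₆ ∧ y₅ ≤ x₅ ∧ y₆ ≤ x₆ :=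
    ⟨min y x₅, y - min y x₅, by omega⟩
  refine ⟨![p 0, p 3 + y₁, p 0 + y₂, p 3, p 0 + y₄, p 3 + y₅, p 0 + y₆, p 3 + y₇],
    ⟨0, isNormal_of_excess (a := p 0) (b := p 3) (x₁ := y₁) (x₂ := y₂) (x₄ := y₄) (x₅ := y₅)
      (x₆ := y₆) (x₇ := y₇) (by simp) h⟩, ?_, ?_⟩
  · simp only [Fin.forall_fin_succ, Fin.forall_fin_zero]
    exact ⟨le_rfl, (by omega : p 3 + y₁ ≤ p 1), (by omega : p 0 + y₂ ≤ p 2), le_rfl,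
      (by omega : p 0 + y₄ ≤ p 4), (by omega : p 3 + y₅ ≤ p 5), (by omega : p 0 + y₆ ≤ p 6),
      (by omega : p 3 + y₇ ≤ p 7), trivial⟩
  · rcases hm with hm | hm | hm | hm | hm
    · exact ⟨1, (by omega : p 0 + y₄ = p 4), (by omega : p 3 + y₅ = p 5),
        (by omega : p 0 + y₆ = p 6), (by omega : p 3 + y₇ = p 7), rfl⟩
    · exact ⟨2, (by omega : p 3 + y₅ = p 5), (by omega : p 0 + y₆ = p 6),
        (by omega : p 3 + y₇ = p 7), rfl, (by omega : p 3 + y₁ = p 1)⟩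
    · exact ⟨4, (by omega : p 3 + y₇ = p 7), rfl, (by omega : p 3 + y₁ = p 1),
        (by omega : p 0 + y₂ = p 2), rfl⟩
    · exact ⟨5, rfl, (by omega : p 3 + y₁ = p 1), (by omega : p 0 + y₂ = p 2), rfl,
        (by omega : p 0 + y₄ = p 4)⟩
    · exact ⟨7, (by omega : p 0 + y₂ = p 2), rfl, (by omega : p 0 + y₄ = p 4),
        (by omega : p 3 + y₅ = p 5), (by omega : p 0 + y₆ = p 6)⟩

theorem isBalanced_zero_left_of_eq {b d e : ℕ} (h : b = d + e) : IsBalanced 0 b 0 d e :=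
  (isBalanced_zero_zero_iff.2 h).rotate.rotate

/-- Every target has a reduced circle with two non-adjacent zeros, so only one additive equation has
to be met. The reflection `i ↦ 1 - i` pairs `c1` with `c3` and `c2` with `c4`. In the last two cases
excesses 4 and 5 are emptied and `x₂ + x₃ = x₆ + x₇` is enforced; the failure of `c2` and `c4` keeps
the subtractions exact. -/
theorem reaches_of_adjacent_minima {p : Fin 8 → ℕ} (h0 : p 0 ≤ p 2 ∧ p 0 ≤ p 4 ∧ p 0 ≤ p 6)
    (h3 : p 1 ≤ p 3 ∧ p 1 ≤ p 5 ∧ p 1 ≤ p 7) : Reaches p := by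
  obtain ⟨x₂, h2⟩ := Nat.exists_eq_add_of_le h0.1
  obtain ⟨x₃, h3'⟩ := Nat.exists_eq_add_of_le h3.1
  obtain ⟨x₄, h4⟩ := Nat.exists_eq_add_of_le h0.2.1
  obtain ⟨x₅, h5⟩ := Nat.exists_eq_add_of_le h3.2.1
  obtain ⟨x₆, h6⟩ := Nat.exists_eq_add_of_le h0.2.2
  obtain ⟨x₇, h7⟩ := Nat.exists_eq_add_of_le h3.2.2
  have le_of : ∀ y₂ y₃ y₄ y₅ y₆ y₇ : ℕ, y₂ ≤ x₂ → y₃ ≤ x₃ → y₄ ≤ x₄ → y₅ ≤ x₅ → y₆ ≤ x₆ →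
      y₇ ≤ x₇ → ∀ j, ![p 0, p 1, p 0 + y₂, p 1 + y₃, p 0 + y₄, p 1 + y₅, p 0 + y₆, p 1 + y₇] j
        ≤ p j := by
    intro y₂ y₃ y₄ y₅ y₆ y₇ l2 l3 l4 l5 l6 l7
    simp only [Fin.forall_fin_succ, Fin.forall_fin_zero]
    exact ⟨le_rfl, le_rfl, (by omega : p 0 + y₂ ≤ p 2), (by omega : p 1 + y₃ ≤ p 3),
      (by omega : p 0 + y₄ ≤ p 4), (by omega : p 1 + y₅ ≤ p 5), (by omega : p 0 + y₆ ≤ p 6),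
      (by omega : p 1 + y₇ ≤ p 7), trivial⟩
  by_cases c1 : x₅ + x₆ + x₇ ≤ x₂
  · refine ⟨_, ⟨0, isNormal_of_excess (a := p 0) (b := p 1) (x₁ := 0) (x₂ := x₅ + x₆ + x₇)
      (x₄ := 0) (x₅ := x₅) (x₆ := x₆) (x₇ := x₇) ?_ (isBalanced_zero_left_of_eq rfl)⟩,
      le_of (x₅ + x₆ + x₇) 0 0 x₅ x₆ x₇ (by omega) (by omega) (by omega) (by omega) (by omega)
        (by omega), 2, h5.symm, h6.symm, h7.symm, rfl, rfl⟩
    simp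
  by_cases c2 : x₆ + x₇ ≤ x₂
  · refine ⟨_, ⟨0, isNormal_of_excess (a := p 0) (b := p 1) (x₁ := 0) (x₂ := x₂)
      (x₄ := 0) (x₅ := x₂ - (x₆ + x₇)) (x₆ := x₆) (x₇ := x₇) ?_
      (isBalanced_zero_left_of_eq (by omega))⟩,
      le_of x₂ 0 0 (x₂ - (x₆ + x₇)) x₆ x₇ (by omega) (by omega) (by omega) (by omega) (by omega)
        (by omega), 3, h6.symm, h7.symm, rfl, rfl, h2.symm⟩
    simp
  by_cases c3 : x₂ + x₃ + x₄ ≤ x₇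
  · refine ⟨_, ⟨6, isNormal_of_excess (a := p 0) (b := p 1) (x₁ := x₂ + x₃ + x₄) (x₂ := 0)
      (x₄ := x₂) (x₅ := x₃) (x₆ := x₄) (x₇ := 0) ?_
      (isBalanced_zero_left_of_eq (by omega)).rotate⟩,
      le_of x₂ x₃ x₄ 0 0 (x₂ + x₃ + x₄) (by omega) (by omega) (by omega) (by omega) (by omega)
        (by omega), 5, rfl, rfl, h2.symm, h3'.symm, h4.symm⟩
    simp
  by_cases c4 : x₂ + x₃ ≤ x₇
  · refine ⟨_, ⟨6, isNormal_of_excess (a := p 0) (b := p 1) (x₁ := x₇) (x₂ := 0)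
      (x₄ := x₂) (x₅ := x₃) (x₆ := x₇ - (x₂ + x₃)) (x₇ := 0) ?_
      (isBalanced_zero_left_of_eq (by omega)).rotate⟩,
      le_of x₂ x₃ (x₇ - (x₂ + x₃)) 0 0 x₇ (by omega) (by omega) (by omega) (by omega) (by omega)
        (by omega), 4, h7.symm, rfl, rfl, h2.symm, h3'.symm⟩
    simp
  by_cases c5 : x₆ + x₇ ≤ x₂ + x₃
  · refine ⟨_, ⟨5, isNormal_of_excess (a := p 1) (b := p 0) (x₁ := x₆) (x₂ := x₇)
      (x₄ := 0) (x₅ := x₂) (x₆ := x₆ + x₇ - x₂) (x₇ := 0) ?_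
      (isBalanced_zero_zero_iff.2 (by omega))⟩,
      le_of x₂ (x₆ + x₇ - x₂) 0 0 x₆ x₇ (by omega) (by omega) (by omega) (by omega) (by omega)
        (by omega), 3, h6.symm, h7.symm, rfl, rfl, h2.symm⟩
    simp
  · refine ⟨_, ⟨1, isNormal_of_excess (a := p 1) (b := p 0) (x₁ := x₂) (x₂ := x₃)
      (x₄ := 0) (x₅ := x₂ + x₃ - x₇) (x₆ := x₇) (x₇ := 0) ?_
      (isBalanced_zero_zero_iff.2 (by omega))⟩,
      le_of x₂ x₃ 0 0 (x₂ + x₃ - x₇) x₇ (by omega) (by omega) (by omega) (by omega) (by omega)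
        (by omega), 4, h7.symm, rfl, rfl, h2.symm, h3'.symm⟩
    simp

theorem exists_min_four (w x y z : ℕ) : (w ≤ x ∧ w ≤ y ∧ w ≤ z) ∨ (x ≤ y ∧ x ≤ z ∧ x ≤ w) ∨
    (y ≤ z ∧ y ≤ w ∧ y ≤ x) ∨ (z ≤ w ∧ z ≤ x ∧ z ≤ y) := by omega

theorem reaches (p : Fin 8 → ℕ) : Reaches p := by
  wlog h0 : p 0 ≤ p 2 ∧ p 0 ≤ p 4 ∧ p 0 ≤ p 6 generalizing p
  · rcases exists_min_four (p 0) (p 2) (p 4) (p 6) with h | h | h | h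
    · exact this p h
    · exact (this (fun i => p (2 + i)) h).of_rotate
    · exact (this (fun i => p (4 + i)) h).of_rotate
    · exact (this (fun i => p (6 + i)) h).of_rotate
  rcases exists_min_four (p 1) (p 3) (p 5) (p 7) with h | h | h | h
  · exact reaches_of_adjacent_minima h0 h
  · exact reaches_of_minima h0 (by omega)
  · exact (reaches_of_minima (p := fun i => p (5 + i)) h ⟨h0.2.2, h0.1, h0.2.1⟩).of_rotate
  · exact (reaches_of_adjacent_minima (p := fun i => p (7 + i)) h h0).of_rotate

end CN83

/-! ### No move between normalizable positions -/

namespace CN52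

/-- A zero in a balanced circle forces a second one not adjacent to it. -/
theorem IsBalanced.zero_left {b c d e : ℕ} (h : IsBalanced 0 b c d e) :
    (c = 0 ∧ b = d + e) ∨ (d = 0 ∧ e = b + c) := by
  rcases h with h | h | h | h | h <;> simp only [CN52.Balanced] at h <;> omega

end CN52

namespace CN83

/-- `q` arises from `p` by removing tokens from the stacks `m`, `m + 1`, `m + 2`; at least one
token in total. -/
structure MoveAt (m : Fin 8) (p q : Fin 8 → ℕ) : Prop where
  le : q m ≤ p m ∧ q (m + 1) ≤ p (m + 1) ∧ q (m + 2) ≤ p (m + 2)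
  lt : q m + q (m + 1) + q (m + 2) < p m + p (m + 1) + p (m + 2)
  eq : q (m + 3) = p (m + 3) ∧ q (m + 4) = p (m + 4) ∧ q (m + 5) = p (m + 5) ∧
        q (m + 6) = p (m + 6) ∧ q (m + 7) = p (m + 7)

theorem moveAt_iff {m : Fin 8} {p q : Fin 8 → ℕ} : MoveAt m p q ↔ p ≠ q ∧ (∀ j, q j ≤ p j) ∧
    q (m + 3) = p (m + 3) ∧ q (m + 4) = p (m + 4) ∧ q (m + 5) = p (m + 5) ∧
      q (m + 6) = p (m + 6) ∧ q (m + 7) = p (m + 7) := by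
  have cover : ∀ m j : Fin 8, j = m ∨ j = m + 1 ∨ j = m + 2 ∨ j = m + 3 ∨ j = m + 4 ∨
    j = m + 5 ∨ j = m + 6 ∨ j = m + 7 := by decide
  constructor
  · rintro ⟨⟨l0, l1, l2⟩, hlt, h⟩
    refine ⟨fun e => ?_, fun j => ?_, h⟩
    · subst e
      exact hlt.false
    · rcases cover m j with rfl | rfl | rfl | rfl | rfl | rfl | rfl | rfl <;> omega
  · rintro ⟨hne, hle, h⟩
    have l0 := hle m
    have l1 := hle (m + 1)
    have l2 := hle (m + 2)
    refine ⟨⟨l0, l1, l2⟩, ?_, h⟩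
    by_contra hlt
    refine hne (funext fun j => ?_)
    rcases cover m j with rfl | rfl | rfl | rfl | rfl | rfl | rfl | rfl <;> omega

theorem MoveAt.reflect {m : Fin 8} {p q : Fin 8 → ℕ} (h : MoveAt m p q) :
    MoveAt (1 - m) (fun i => p (3 - i)) (fun i => q (3 - i)) := by
  rw [moveAt_iff] at *
  obtain ⟨hne, hle, h3, h4, h5, h6, h7⟩ := h
  have e : ∀ m k : Fin 8, 3 - (1 - m + k) = m + (2 - k) := by decide
  refine ⟨fun h => hne (funext fun j => ?_), fun j => hle _, ?_⟩
  · simpa using congrFun h (3 - j)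
  · simp only [e]
    exact ⟨h7, h6, h5, h4, h3⟩

/-- These windows avoid stack 0, so only the odd minimum can drop, shifting all odd excesses
together. The other four windows are their mirror images. -/
theorem IsNormal.not_isNormal_of_mem {p q : Fin 8 → ℕ} {m : Fin 8} (hp : IsNormal p)
    (h : MoveAt m p q) (hm : m = 1 ∨ m = 2 ∨ m = 3 ∨ m = 4) : ¬ IsNormal q := by
  intro hq
  obtain ⟨hle, hlt, heq⟩ := h
  obtain ⟨a, b, x₁, x₂, x₄, x₅, x₆, x₇, ⟨e0, e1, e2, e3, e4, e5, e6, e7⟩, hx⟩ := hp.exists_excess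
  obtain ⟨a', b', y₁, y₂, y₄, y₅, y₆, y₇, ⟨f0, f1, f2, f3, f4, f5, f6, f7⟩, hy⟩ :=
    hq.exists_excess
  clear hp hq
  rcases hm with rfl | rfl | rfl | rfl <;>
    simp only [Fin.reduceAdd, Fin.isValue, e0, e1, e2, e3, e4, e5, e6, e7,
      f0, f1, f2, f3, f4, f5, f6, f7] at hlt hle heq <;>
    clear e0 e1 e2 e3 e4 e5 e6 e7 f0 f1 f2 f3 f4 f5 f6 f7 <;>
  rcases hx with h | h | h | h | h <;> rcases hy with h' | h' | h' | h' | h' <;>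
    simp only [CN52.Balanced] at h h' <;> omega

theorem IsNormal.not_isNormal {p q : Fin 8 → ℕ} {m : Fin 8} (hp : IsNormal p)
    (h : MoveAt m p q) : ¬ IsNormal q := by
  by_cases hm : m = 1 ∨ m = 2 ∨ m = 3 ∨ m = 4
  · exact hp.not_isNormal_of_mem h hm
  · have hm' : 1 - m = 1 ∨ 1 - m = 2 ∨ 1 - m = 3 ∨ 1 - m = 4 := by
      clear h; revert m; decide
    exact fun hq => hp.reflect.not_isNormal_of_mem h.reflect hm' hq.reflect

theorem IsNormal.not_isNormal_rotate_three {p q : Fin 8 → ℕ} {m : Fin 8} (hp : IsNormal p)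
    (h : MoveAt m p q) (hm : m = 4 ∨ m = 5 ∨ m = 6) : ¬ IsNormal fun i => q (3 + i) := by
  intro hq
  obtain ⟨hle, hlt, heq⟩ := h
  obtain ⟨a, b, x₁, x₂, x₄, x₅, x₆, x₇, ⟨e0, e1, e2, e3, e4, e5, e6, e7⟩, hx⟩ := hp.exists_excess
  obtain ⟨a', b', y₁, y₂, y₄, y₅, y₆, y₇, f, hy⟩ := hq.exists_excess
  simp only [Fin.reduceAdd, Fin.isValue] at f
  obtain ⟨f0, f1, f2, f3, f4, f5, f6, f7⟩ := f
  clear hp hq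
  rcases hm with rfl | rfl | rfl <;>
    simp only [Fin.reduceAdd, Fin.isValue, e0, e1, e2, e3, e4, e5, e6, e7,
      f0, f1, f2, f3, f4, f5, f6, f7] at hlt hle heq <;>
    clear e0 e1 e2 e3 e4 e5 e6 e7 f0 f1 f2 f3 f4 f5 f6 f7 <;>
  rcases hx with h | h | h | h | h <;> rcases hy with h' | h' | h' | h' | h' <;>
    simp only [CN52.Balanced] at h h' <;> omega

/-- Stack 3 ties with the new minimum 5, which puts a zero into the rotated circle, and `zero_left`
makes the balance of `q` additive. The next three lemmas use the zero at stack 3 in the same way. -/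
theorem IsNormal.not_isNormal_rotate_two {p q : Fin 8 → ℕ} {m : Fin 8} (hp : IsNormal p)
    (h : MoveAt m p q) (hm : m = 0 ∨ m = 1 ∨ m = 2) (h3 : q 3 ≤ q 5) :
    ¬ IsNormal fun i => q (2 + i) := by
  intro hq
  obtain ⟨hle, hlt, heq⟩ := h
  obtain ⟨a, b, x₁, x₂, x₄, x₅, x₆, x₇, ⟨e0, e1, e2, e3, e4, e5, e6, e7⟩, hx⟩ := hp.exists_excess
  obtain ⟨a', b', y₁, y₂, y₄, y₅, y₆, y₇, f, hy⟩ := hq.exists_excess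
  simp only [Fin.reduceAdd, Fin.isValue] at f
  obtain ⟨f0, f1, f2, f3, f4, f5, f6, f7⟩ := f
  obtain rfl : y₁ = 0 := by omega
  clear hp hq
  rcases hm with rfl | rfl | rfl <;>
    simp only [Fin.reduceAdd, Fin.isValue, e0, e1, e2, e3, e4, e5, e6, e7,
      f0, f1, f2, f3, f4, f5, f6, f7] at hlt hle heq <;>
    clear e0 e1 e2 e3 e4 e5 e6 e7 f0 f1 f2 f3 f4 f5 f6 f7 h3 <;>
  rcases hy.zero_left with h' | h' <;> rcases hx with h | h | h | h | h <;>
    simp only [CN52.Balanced] at h <;> omega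

theorem IsNormal.not_isNormal_rotate_seven {p q : Fin 8 → ℕ} {m : Fin 8} (hp : IsNormal p)
    (h : MoveAt m p q) (hm : m = 0 ∨ m = 1 ∨ m = 2) (h3 : q 3 ≤ q 7) :
    ¬ IsNormal fun i => q (7 + i) := by
  intro hq
  obtain ⟨hle, hlt, heq⟩ := h
  obtain ⟨a, b, x₁, x₂, x₄, x₅, x₆, x₇, ⟨e0, e1, e2, e3, e4, e5, e6, e7⟩, hx⟩ := hp.exists_excess
  obtain ⟨a', b', y₁, y₂, y₄, y₅, y₆, y₇, f, hy⟩ := hq.exists_excess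
  simp only [Fin.reduceAdd, Fin.isValue] at f
  obtain ⟨f0, f1, f2, f3, f4, f5, f6, f7⟩ := f
  obtain rfl : y₄ = 0 := by omega
  -- The window misses stack 7, so `p 7 = q 7 ≤ q 3 ≤ p 3`.
  obtain rfl : x₇ = 0 := by
    rcases hm with rfl | rfl | rfl <;> simp only [Fin.reduceAdd, Fin.isValue] at hle heq <;> omega
  clear hp hq
  rcases hm with rfl | rfl | rfl <;>
    simp only [Fin.reduceAdd, Fin.isValue, e0, e1, e2, e3, e4, e5, e6, e7,
      f0, f1, f2, f3, f4, f5, f6, f7] at hlt hle heq <;>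
    clear e0 e1 e2 e3 e4 e5 e6 e7 f0 f1 f2 f3 f4 f5 f6 f7 h3 <;>
  rcases hx.rotate.rotate.rotate.rotate.zero_left with h | h <;>
    rcases hy.rotate.rotate.zero_left with h' | h' <;> omega

theorem IsNormal.not_isNormal_rotate_four {p q : Fin 8 → ℕ} {m : Fin 8} (hp : IsNormal p)
    (h : MoveAt m p q) (hm : m = 2 ∨ m = 3 ∨ m = 4) (h3 : q 3 ≤ q 7) :
    ¬ IsNormal fun i => q (4 + i) := by
  intro hq
  obtain ⟨hle, hlt, heq⟩ := h
  obtain ⟨a, b, x₁, x₂, x₄, x₅, x₆, x₇, ⟨e0, e1, e2, e3, e4, e5, e6, e7⟩, hx⟩ := hp.exists_excess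
  obtain ⟨a', b', y₁, y₂, y₄, y₅, y₆, y₇, f, hy⟩ := hq.exists_excess
  simp only [Fin.reduceAdd, Fin.isValue] at f
  obtain ⟨f0, f1, f2, f3, f4, f5, f6, f7⟩ := f
  obtain rfl : y₇ = 0 := by omega
  clear hp hq
  rcases hm with rfl | rfl | rfl <;>
    simp only [Fin.reduceAdd, Fin.isValue, e0, e1, e2, e3, e4, e5, e6, e7,
      f0, f1, f2, f3, f4, f5, f6, f7] at hlt hle heq <;>
    clear e0 e1 e2 e3 e4 e5 e6 e7 f0 f1 f2 f3 f4 f5 f6 f7 h3 <;>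
  rcases hy.rotate.rotate.rotate.rotate.zero_left with h' | h' <;>
  rcases hx with h | h | h | h | h <;> simp only [CN52.Balanced] at h <;> omega

theorem IsNormal.not_isNormal_rotate_one {p q : Fin 8 → ℕ} {m : Fin 8} (hp : IsNormal p)
    (h : MoveAt m p q) (hm : m = 2 ∨ m = 3 ∨ m = 4) (h3 : q 3 ≤ q 1) :
    ¬ IsNormal fun i => q (1 + i) := by
  intro hq
  obtain ⟨hle, hlt, heq⟩ := h
  obtain ⟨a, b, x₁, x₂, x₄, x₅, x₆, x₇, ⟨e0, e1, e2, e3, e4, e5, e6, e7⟩, hx⟩ := hp.exists_excess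
  obtain ⟨a', b', y₁, y₂, y₄, y₅, y₆, y₇, f, hy⟩ := hq.exists_excess
  simp only [Fin.reduceAdd, Fin.isValue] at f
  obtain ⟨f0, f1, f2, f3, f4, f5, f6, f7⟩ := f
  obtain rfl : y₂ = 0 := by omega
  clear hp hq
  rcases hm with rfl | rfl | rfl <;>
    simp only [Fin.reduceAdd, Fin.isValue, e0, e1, e2, e3, e4, e5, e6, e7,
      f0, f1, f2, f3, f4, f5, f6, f7] at hlt hle heq <;>
    clear e0 e1 e2 e3 e4 e5 e6 e7 f0 f1 f2 f3 f4 f5 f6 f7 h3 <;>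
  rcases hy.rotate.zero_left with h' | h' <;>
  rcases hx with h | h | h | h | h <;> simp only [CN52.Balanced] at h <;> omega

theorem MoveAt.mem_or_eq {m : Fin 8} {p q : Fin 8 → ℕ} (h : MoveAt m p q) (c : Fin 8) :
    (m = c - 2 ∨ m = c - 1 ∨ m = c) ∨ q c = p c := by
  obtain ⟨-, -, h3, h4, h5, h6, h7⟩ := h
  have key : ∀ m c : Fin 8, (m = c - 2 ∨ m = c - 1 ∨ m = c) ∨
      c = m + 3 ∨ c = m + 4 ∨ c = m + 5 ∨ c = m + 6 ∨ c = m + 7 := by decide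
  rcases key m c with h | rfl | rfl | rfl | rfl | rfl
  · exact .inl h
  all_goals exact .inr ‹_›

theorem IsNormal.not_isNormal_rotate_of_le {p q : Fin 8 → ℕ} {m : Fin 8} (hp : IsNormal p)
    (h : MoveAt m p q) (h3 : q 3 ≤ q 1 ∧ q 3 ≤ q 5 ∧ q 3 ≤ q 7) (c : Fin 8) :
    ¬ IsNormal fun i => q (c + i) := by
  intro hq
  have hle := (moveAt_iff.1 h).2.1 0
  have hp0 := hp.1
  -- A minimum at 0 or 6 would pair with stack 3, and `IsNormal.rotate` would carry normality to
  -- that pair. So the even minimum lies only at 2 or 4, leaving `c` = 1, 2, 4, 7.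
  have h0 : ¬ (q 0 ≤ q 2 ∧ q 0 ≤ q 4 ∧ q 0 ≤ q 6) := fun h0 => hp.not_isNormal h <| by
    simpa only [add_neg_cancel_left] using hq.rotate (c := -c)
      (by simpa only [add_neg_cancel_left, add_neg_cancel] using h0)
      (by simpa only [add_neg_cancel_left] using h3)
  have h6 : ¬ (q 6 ≤ q 0 ∧ q 6 ≤ q 2 ∧ q 6 ≤ q 4) := fun h6 => by
    refine hp.not_isNormal_rotate_three h ((h.mem_or_eq 6).resolve_right (by omega)) ?_
    simpa only [← add_assoc, add_sub_cancel] using hq.rotate (c := 3 - c)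
      (by simpa only [← add_assoc, add_sub_cancel] using ⟨h3.2.1, h3.2.2, h3.1⟩)
      (by simpa only [← add_assoc, add_sub_cancel] using ⟨h6.2.2, h6.1, h6.2.1⟩)
  have hm := hq.1
  have hm' := hq.2.1
  rcases fin_eight_cases c with rfl | rfl | rfl | rfl | rfl | rfl | rfl | rfl <;>
    simp only [Fin.reduceAdd, Fin.isValue] at hm hm'
  · exact h0 hm
  · exact hp.not_isNormal_rotate_one h ((h.mem_or_eq 4).resolve_right (by omega)) h3.1 hq
  · exact hp.not_isNormal_rotate_two h ((h.mem_or_eq 2).resolve_right (by omega)) h3.2.1 hq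
  · omega
  · exact hp.not_isNormal_rotate_four h ((h.mem_or_eq 4).resolve_right (by omega)) h3.2.2 hq
  · omega
  · omega
  · exact hp.not_isNormal_rotate_seven h ((h.mem_or_eq 2).resolve_right (by omega)) h3.2.2 hq

theorem IsNormal.not_isNormal_rotate {p q : Fin 8 → ℕ} {m : Fin 8} (hp : IsNormal p)
    (h : MoveAt m p q) (c : Fin 8) : ¬ IsNormal fun i => q (c + i) := by
  intro hq
  have key : ∀ m c : Fin 8, ¬ ((m = c - 2 ∨ m = c - 1 ∨ m = c) ∧
      (m = c + 3 - 2 ∨ m = c + 3 - 1 ∨ m = c + 3)) := by decide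
  have hc : q c = p c ∨ q (c + 3) = p (c + 3) := by
    have := key m c
    have := h.mem_or_eq c
    have := h.mem_or_eq (c + 3)
    tauto
  -- An untouched new minimum was at least the old minimum of its square, which can only have
  -- decreased; hence the old one is still minimal.
  have min : (q 3 ≤ q 1 ∧ q 3 ≤ q 5 ∧ q 3 ≤ q 7) ∨ (q 0 ≤ q 2 ∧ q 0 ≤ q 4 ∧ q 0 ≤ q 6) := by
    have hle0 := (moveAt_iff.1 h).2.1 0
    have hle3 := (moveAt_iff.1 h).2.1 3
    have hp0 := hp.1
    have hp3 := hp.2.1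
    have hm := hq.1
    have hm' := hq.2.1
    rcases fin_eight_cases c with rfl | rfl | rfl | rfl | rfl | rfl | rfl | rfl <;>
      simp only [Fin.reduceAdd, Fin.isValue] at hm hm' hc <;> omega
  rcases min with h3 | h0
  · exact hp.not_isNormal_rotate_of_le h h3 c hq
  · have e : ∀ c i : Fin 8, 3 - (-c + i) = c + (3 - i) := by decide
    refine hp.reflect.not_isNormal_rotate_of_le h.reflect ⟨h0.1, h0.2.2, h0.2.1⟩ (-c) ?_
    simpa only [e] using hq.reflect

/-! ### The P-positions of CN(8,3) -/

theorem mem_pPositions_iff_isNormalizable (p : Fin 8 → ℕ) :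
    p ∈ PPositions 8 3 ↔ IsNormalizable p := by
  refine isPPosition_iff_of_kernel ?_ ?_ p
  · rintro p q ⟨c, hp⟩ hm ⟨d, hq⟩
    obtain ⟨hne, hle, i, hi⟩ := move_eight_three_iff.1 hm
    refine hp.not_isNormal_rotate (q := fun i => q (c + i)) (m := i - c)
      (moveAt_iff.2 ⟨fun e => hne (funext fun j => ?_), fun j => hle _, ?_⟩) (d - c) ?_
    · simpa using congrFun e (j - c)
    · simpa only [← add_assoc, add_sub_cancel] using hi
    · simpa only [← add_assoc, add_sub_cancel] using hq
  · intro p hp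
    obtain ⟨q, hq, hle, hi⟩ := reaches p
    exact ⟨q, move_eight_three_iff.2 ⟨fun h => hp (h ▸ hq), hle, hi⟩, hq⟩

theorem isNormal_iff (p : Fin 8 → ℕ) :
    IsNormal p ↔ p 0 = a p ∧ x p 3 = 0 ∧ reduced p ∈ PPositions 5 2 := by
  rw [CN52.mem_pPositions_iff]
  have e : p 0 = a p → p 3 = b p → (IsBalanced (reduced p 0) (reduced p 1) (reduced p 2)
      (reduced p 3) (reduced p 4) ↔ IsBalanced (p 1 - p 3) (p 2 - p 0) (p 4 - p 0)
        ((p 5 - p 3) + (p 6 - p 0)) (p 7 - p 3)) := by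
    intro h0 h3
    rw [h0, h3]
    rfl
  have ha : (p 0 ≤ p 2 ∧ p 0 ≤ p 4 ∧ p 0 ≤ p 6) ↔ p 0 = a p := by unfold a; omega
  have hb : (p 3 ≤ p 1 ∧ p 3 ≤ p 5 ∧ p 3 ≤ p 7) ↔ p 3 = b p := by unfold b; omega
  have hx : x p 3 = 0 ↔ p 3 = b p := by
    change p 3 - b p = 0 ↔ p 3 = b p
    unfold b; omega
  rw [hx, IsNormal, ha, hb]
  exact and_congr_right fun h0 => and_congr_right fun h3 => (e h0 h3).symm

theorem mem_pPositions_iff_of_minima {p : Fin 8 → ℕ} (h0 : p 0 = a p) (h3 : x p 3 = 0) :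
    p ∈ PPositions 8 3 ↔ reduced p ∈ PPositions 5 2 := by
  rw [mem_pPositions_iff_isNormalizable]
  constructor
  · rintro ⟨c, hc⟩
    have h0' : p 0 ≤ p 2 ∧ p 0 ≤ p 4 ∧ p 0 ≤ p 6 := by unfold a at h0; omega
    have h3' : p 3 ≤ p 1 ∧ p 3 ≤ p 5 ∧ p 3 ≤ p 7 := by
      have : p 3 - b p = 0 := h3
      unfold b at this; omega
    have := hc.rotate (c := -c) (by simpa only [add_neg_cancel_left] using by simpa using h0')
      (by simpa only [add_neg_cancel_left] using h3')
    exact ((isNormal_iff p).1 (by simpa only [add_neg_cancel_left] using this)).2.2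
  · exact fun h => ⟨0, by simpa using (isNormal_iff p).2 ⟨h0, h3, h⟩⟩

theorem a_reflect (p : Fin 8 → ℕ) : a (fun i => p (3 - i)) = b p := by
  change min (min (p 3) (p 1)) (min (p 7) (p 5)) = min (min (p 1) (p 3)) (min (p 5) (p 7))
  omega

theorem b_reflect (p : Fin 8 → ℕ) : b (fun i => p (3 - i)) = a p := by
  change min (min (p 2) (p 0)) (min (p 6) (p 4)) = min (min (p 0) (p 2)) (min (p 4) (p 6))
  omega

end CN83

theorem theorem6p3 :
    (∀ p : Fin 8 → ℕ, p ∈ CircularNim.PPositions 8 3 ↔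
      ∃ q : Fin 8 → ℕ, CircularNim.IsRelabeling p q ∧ CN83.a q ≤ CN83.b q ∧
        q 0 = CN83.a q ∧ CN83.x q 3 = 0 ∧
        CN83.reduced q ∈ CircularNim.PPositions 5 2) ∧
    (∀ p : Fin 8 → ℕ, p 0 = CN83.a p → CN83.x p 3 = 0 →
      (p ∈ CircularNim.PPositions 8 3 ↔
        CN83.reduced p ∈ CircularNim.PPositions 5 2)) := by
  refine ⟨fun p => ?_, fun p => CN83.mem_pPositions_iff_of_minima⟩
  simp only [← CN83.isNormal_iff]
  rw [CN83.mem_pPositions_iff_isNormalizable]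
  constructor
  · rintro ⟨c, h⟩
    rcases le_total (CN83.a fun i => p (c + i)) (CN83.b fun i => p (c + i)) with hab | hab
    · exact ⟨_, ⟨c, .inl fun _ => rfl⟩, hab, h⟩
    -- Reflecting by `i ↦ 3 - i` swaps `a` and `b` and preserves normality.
    · refine ⟨_, ⟨c + 3, .inr fun i => ?_⟩, ?_, h.reflect⟩
      · rw [add_sub_assoc]
      · rwa [CN83.a_reflect fun i => p (c + i), CN83.b_reflect fun i => p (c + i)]
  · rintro ⟨q, ⟨c, hq | hq⟩, -, h⟩
    · rw [funext hq] at h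
      exact ⟨c, h⟩
    · refine ⟨c - 3, ?_⟩
      have := h.reflect
      have e : ∀ c i : Fin 8, c - (3 - i) = c - 3 + i := by decide
      simpa only [hq, e] using this
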